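/- **Model.** Let $d,d',K,n$ be non-negative integers, $\mu\in\mathbb R^{d'}$, $\Sigma\in\mathbb R^{d'\times d'}$ and $\Sigma_a\in\mathbb R^{d\times d}$ ($a\in[K]$) symmetric positive definite, $W_a\in\mathbb R^{d\times d'}$ arbitrary, $\sigma>0$, and $\phi:\mathcal X\to\mathbb R^d$ a measurable feature map on a measurable space of contexts. On a probability space let $\psi$ (latent parameter, in $\mathbb R^{d'}$), $\theta=(\theta_a)_{a\in[K]}$ (action parameters, in $\mathbb R^d$) and the sample set $S=(X_i,A_i,R_i)_{i\in[n]}$ (contexts in $\mathcal X$, actions in $[K]$, real rewards) satisfy $$\psi\sim\mathcal N(\mu,\Sigma),\qquad \theta_a\mid\psi\sim\mathcal N(W_a\psi,\Sigma_a)\ \ (a\in[K]),\qquad R_i\mid\psi,\theta,(X_j,A_j)_{j\in[n]}\sim\mathcal N(\phi(X_i)^\top\theta_{A_i},\sigma^2)\ \ (i\in[n]),$$ where $(X_j,A_j)_{j\in[n]}$ is independent of $\psi$ and, given $\psi$, independent of $\theta$; given $\psi$, the $\theta_a$ are independent; and given $\psi,\theta,(X_j,A_j)_{j\in[n]}$,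 the rewards $R_1,\dots,R_n$ are independent. Put $$G_a=\sigma^{-2}\sum_{i:A_i=a}\phi(X_i)\phi(X_i)^\top,\qquad B_a=\sigma^{-2}\sum_{i:A_i=a}R_i\,\phi(X_i),\qquad \tilde\Sigma_a=(G_a+\Sigma_a^{-1})^{-1}.$$ **Claim.** All matrices inverted above and below are positive definite, and so are the covariances $\bar\Sigma$, $\tilde\Sigma_a$, $\hat\Sigma_a$. The following hold almost surely, for regular conditional distributions. 1. (Latent posterior) $\psi\mid S\sim\mathcal N(\bar\mu,\bar\Sigma)$, where $$\bar\Sigma^{-1}=\Sigma^{-1}+\sum_{a\in[K]}W_a^\top\big(\Sigma_a^{-1}-\Sigma_a^{-1}(G_a+\Sigma_a^{-1})^{-1}\Sigma_a^{-1}\big)W_a,\qquad \bar\Sigma^{-1}\bar\mu=\Sigma^{-1}\mu+\sum_{a\in[K]}W_a^\top\Sigma_a^{-1}(G_a+\Sigma_a^{-1})^{-1}B_a .$$ 2. (Conditional posterior) For every $a\in[K]$, $\theta_a\mid\psi,S\sim\mathcal N\big(\tilde\Sigma_a(B_a+\Sigma_a^{-1}W_a\psi),\ \tilde\Sigma_a\big)$;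 moreover, given $(\psi,S)$, the $\theta_a$, $a\in[K]$, are independent. 3. (Marginal action posterior) For every $a\in[K]$, $\theta_a\mid S\sim\mathcal N(\hat\mu_a,\hat\Sigma_a)$ with $$\hat\mu_a=\tilde\Sigma_a(B_a+\Sigma_a^{-1}W_a\bar\mu),\qquad \hat\Sigma_a=\tilde\Sigma_a+\tilde\Sigma_a\Sigma_a^{-1}W_a\bar\Sigma W_a^\top\Sigma_a^{-1}\tilde\Sigma_a .$$ -/

import Mathlib

open MeasureTheory ProbabilityTheory

noncomputable section

/-- Conditional independence of a finite family of random variables given `Z`: almost surely, the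
regular conditional law of the family given `Z` is the product of the regular conditional laws of
its members. -/
def CondIndepFamily {Ω ι E F : Type*} [MeasurableSpace Ω] [Fintype ι]
    [MeasurableSpace E] [StandardBorelSpace E] [Nonempty E] [MeasurableSpace F]
    (Y : ι → Ω → E) (Z : Ω → F) (P : Measure Ω) [IsFiniteMeasure P] : Prop :=
  ∀ᵐ z ∂(P.map Z), condDistrib (fun ω i => Y i ω) Z P z
    = Measure.pi (fun i => condDistrib (Y i) Z P z)

/-- Conditional independence of `Y` and `V` given `Z`: almost surely, the regular conditional law
of `Y` given `(Z, V)` is that of `Y` given `Z`. -/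
def CondIndepGiven {Ω E F G : Type*} [MeasurableSpace Ω]
    [MeasurableSpace E] [StandardBorelSpace E] [Nonempty E] [MeasurableSpace F] [MeasurableSpace G]
    (Y : Ω → E) (V : Ω → G) (Z : Ω → F) (P : Measure Ω) [IsFiniteMeasure P] : Prop :=
  ∀ᵐ q ∂(P.map fun ω => (Z ω, V ω)),
    condDistrib Y (fun ω => (Z ω, V ω)) P q = condDistrib Y Z P q.1

/-- Parameters of the linear Gaussian hierarchy with `K` actions, action parameters in `ℝ^d` and a
latent parameter in `ℝ^{d'}`, contexts in `𝒳`. -/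
structure HierParams (𝒳 : Type*) (d d' K : ℕ) where
  /-- the prior mean `μ` of the latent parameter -/
  latMean : EuclideanSpace ℝ (Fin d')
  /-- the prior covariance `Σ` of the latent parameter -/
  latCov : Matrix (Fin d') (Fin d') ℝ
  /-- the mixing matrices `W_a` -/
  W : Fin K → Matrix (Fin d) (Fin d') ℝ
  /-- the conditional covariances `Σ_a` of the action parameters -/
  actCov : Fin K → Matrix (Fin d) (Fin d) ℝ
  /-- the feature map `φ` -/
  φ : 𝒳 → EuclideanSpace ℝ (Fin d)
  /-- the standard deviation `σ` of the reward noise -/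
  σ : ℝ

/-- The hierarchical model with the structured independence assumption: the random variables are
the latent parameter `ψ`, the action parameters `θ a`, and the contexts `X i`, actions `A i` and
rewards `R i` of a sample set of size `n`. -/
structure IsHierModel {Ω 𝒳 : Type*} [MeasurableSpace Ω] [MeasurableSpace 𝒳] {d d' K n : ℕ}
    (p : HierParams 𝒳 d d' K) (P : Measure Ω) [IsProbabilityMeasure P]
    (ψ : Ω → EuclideanSpace ℝ (Fin d')) (θ : Fin K → Ω → EuclideanSpace ℝ (Fin d))
    (X : Fin n → Ω → 𝒳) (A : Fin n → Ω → Fin K) (R : Fin n → Ω → ℝ) : Prop where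
  meas_latent : Measurable ψ
  meas_action : ∀ a, Measurable (θ a)
  meas_X : ∀ i, Measurable (X i)
  meas_A : ∀ i, Measurable (A i)
  meas_R : ∀ i, Measurable (R i)
  /-- `ψ ∼ N(μ, Σ)` -/
  latent_law : P.map ψ = multivariateGaussian p.latMean p.latCov
  /-- `θ_a | ψ ∼ N(W_a ψ, Σ_a)` -/
  action_law : ∀ a, ∀ᵐ z ∂(P.map ψ), condDistrib (θ a) ψ P z
    = multivariateGaussian (Matrix.toEuclideanLin (p.W a) z) (p.actCov a)
  /-- given `ψ`, the `θ_a` are independent -/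
  action_indep : CondIndepFamily θ ψ P
  /-- `(X, A)` is independent of `ψ` -/
  design_indep_latent : IndepFun (fun ω i => (X i ω, A i ω)) ψ P
  /-- given `ψ`, `(X, A)` is independent of `θ` -/
  design_indep_action : CondIndepGiven (fun ω a => θ a ω) (fun ω i => (X i ω, A i ω)) ψ P
  /-- `R_i | ψ, θ, X, A ∼ N(φ(X_i)ᵀ θ_{A_i}, σ²)` -/
  reward_law : ∀ i, ∀ᵐ q ∂(P.map fun ω => (ψ ω, (fun a => θ a ω), fun j => (X j ω, A j ω))),
    condDistrib (R i) (fun ω => (ψ ω, (fun a => θ a ω), fun j => (X j ω, A j ω))) P q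
      = gaussianReal (inner ℝ (p.φ (q.2.2 i).1) (q.2.1 (q.2.2 i).2)) (p.σ ^ 2).toNNReal
  /-- given `ψ, θ, X, A`, the rewards are independent -/
  reward_indep : CondIndepFamily R
    (fun ω => (ψ ω, (fun a => θ a ω), fun j => (X j ω, A j ω))) P

/-- The sample set `S = (X_i, A_i, R_i)_i`. -/
def sampleSet {Ω 𝒳 : Type*} {K n : ℕ} (X : Fin n → Ω → 𝒳) (A : Fin n → Ω → Fin K)
    (R : Fin n → Ω → ℝ) : Ω → Fin n → 𝒳 × Fin K × ℝ :=
  fun ω i => (X i ω, A i ω, R i ω)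

namespace HierParams

variable {𝒳 : Type*} {d d' K n : ℕ}

/-- `G_a = σ⁻² ∑_{i : A_i = a} φ(X_i) φ(X_i)ᵀ`, as a function of the sample set
`s = (X_i, A_i, R_i)_i`. -/
def G (p : HierParams 𝒳 d d' K) (s : Fin n → 𝒳 × Fin K × ℝ) (a : Fin K) :
    Matrix (Fin d) (Fin d) ℝ :=
  (p.σ ^ 2)⁻¹ • ∑ i with (s i).2.1 = a,
    Matrix.vecMulVec (p.φ (s i).1).ofLp (p.φ (s i).1).ofLp

/-- `B_a = σ⁻² ∑_{i : A_i = a} R_i φ(X_i)`. -/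
def B (p : HierParams 𝒳 d d' K) (s : Fin n → 𝒳 × Fin K × ℝ) (a : Fin K) :
    EuclideanSpace ℝ (Fin d) :=
  (p.σ ^ 2)⁻¹ • ∑ i with (s i).2.1 = a, (s i).2.2 • p.φ (s i).1

/-- `Σ̄⁻¹ = Σ⁻¹ + ∑_a W_aᵀ (Σ_a⁻¹ - Σ_a⁻¹ (G_a + Σ_a⁻¹)⁻¹ Σ_a⁻¹) W_a`. -/
def latPostPrec (p : HierParams 𝒳 d d' K) (s : Fin n → 𝒳 × Fin K × ℝ) :
    Matrix (Fin d') (Fin d') ℝ :=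
  p.latCov⁻¹ + ∑ a, (p.W a).transpose *
    ((p.actCov a)⁻¹ - (p.actCov a)⁻¹ * (p.G s a + (p.actCov a)⁻¹)⁻¹ * (p.actCov a)⁻¹) * p.W a

/-- `Σ̄`. -/
def latPostCov (p : HierParams 𝒳 d d' K) (s : Fin n → 𝒳 × Fin K × ℝ) :
    Matrix (Fin d') (Fin d') ℝ :=
  (p.latPostPrec s)⁻¹

/-- `μ̄ = Σ̄ (Σ⁻¹ μ + ∑_a W_aᵀ Σ_a⁻¹ (G_a + Σ_a⁻¹)⁻¹ B_a)`. -/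
def latPostMean (p : HierParams 𝒳 d d' K) (s : Fin n → 𝒳 × Fin K × ℝ) :
    EuclideanSpace ℝ (Fin d') :=
  Matrix.toEuclideanLin (p.latPostCov s)
    (Matrix.toEuclideanLin p.latCov⁻¹ p.latMean
      + ∑ a, Matrix.toEuclideanLin
          ((p.W a).transpose * (p.actCov a)⁻¹ * (p.G s a + (p.actCov a)⁻¹)⁻¹) (p.B s a))

/-- `Σ̃_a = (G_a + Σ_a⁻¹)⁻¹`. -/
def condPostCov (p : HierParams 𝒳 d d' K) (s : Fin n → 𝒳 × Fin K × ℝ) (a : Fin K) :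
    Matrix (Fin d) (Fin d) ℝ :=
  (p.G s a + (p.actCov a)⁻¹)⁻¹

/-- `μ̃_a(z) = Σ̃_a (B_a + Σ_a⁻¹ W_a z)`. -/
def condPostMean (p : HierParams 𝒳 d d' K) (s : Fin n → 𝒳 × Fin K × ℝ) (a : Fin K)
    (z : EuclideanSpace ℝ (Fin d')) : EuclideanSpace ℝ (Fin d) :=
  Matrix.toEuclideanLin (p.condPostCov s a)
    (p.B s a + Matrix.toEuclideanLin ((p.actCov a)⁻¹ * p.W a) z)

/-- `Σ̂_a = Σ̃_a + Σ̃_a Σ_a⁻¹ W_a Σ̄ W_aᵀ Σ_a⁻¹ Σ̃_a`. -/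
def margPostCov (p : HierParams 𝒳 d d' K) (s : Fin n → 𝒳 × Fin K × ℝ) (a : Fin K) :
    Matrix (Fin d) (Fin d) ℝ :=
  p.condPostCov s a + p.condPostCov s a * (p.actCov a)⁻¹ * p.W a * p.latPostCov s
    * (p.W a).transpose * (p.actCov a)⁻¹ * p.condPostCov s a

end HierParams

end

open MeasureTheory ProbabilityTheory

noncomputable section

/-! The proof is Gaussian conjugacy, used once per level of the hierarchy. The two independence
assumptions on the design make (X, A) independent of the pair (ψ, θ), so the law of (S, (ψ, θ)) is a
reference law of the sample times the prior, with the Gaussian likelihood as density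
(`map_sample_params`). By Bayes' rule (`condDistrib_ae_eq_of_map_eq_compProd`) a posterior is then
needed only up to a factor depending on the conditioning variable, and the law of the design drops
out.

For a fixed sample the likelihood factors over actions into exponentials of -½⟨θ_a, G_a θ_a⟩ + ⟨B_a,
θ_a⟩. Given ψ = z the prior of θ is a product of Gaussians; completing the square in each θ_a
(`multivariateGaussian_withDensity_exp`) yields the conditional posterior, again a product, and
leaves a factor depending on z. That factor is the exponential of a concave quadratic in z, so the
same lemma applied to the prior of ψ yields the latent posterior. The marginal posterior of θ_a
mixes a Gaussian whose mean is affine in z over this law (`bind_multivariateGaussian`). -/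

/-! ### Densities of product measures and of Gaussians -/

theorem lintegral_pi_fin_prod {n : ℕ} {E : Fin n → Type*} [∀ i, MeasurableSpace (E i)]
    (μ : ∀ i, Measure (E i)) [∀ i, SigmaFinite (μ i)] (f : ∀ i, E i → ENNReal)
    (hf : ∀ i, Measurable (f i)) :
    ∫⁻ x, ∏ i, f i (x i) ∂Measure.pi μ = ∏ i, ∫⁻ y, f i y ∂μ i := by
  induction n with
  | zero => simp
  | succ n ih =>
    rw [← ((measurePreserving_piFinSuccAbove μ 0).symm _).lintegral_comp_emb
      (MeasurableEquiv.measurableEmbedding _)]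
    simp only [Fin.prod_univ_succ, MeasurableEquiv.piFinSuccAbove_symm_apply]
    rw [← ih (fun i => μ i.succ) (fun i => f i.succ) fun i => hf _]
    have hm : Measurable fun x : ∀ i : Fin n, E i.succ => ∏ i, f i.succ (x i) :=
      Finset.measurable_prod _ fun i _ => (hf _).comp (measurable_pi_apply i)
    exact lintegral_prod_mul (ν := Measure.pi fun i : Fin n => μ i.succ) (hf 0).aemeasurable
      hm.aemeasurable

theorem pi_eq_withDensity_fin {n : ℕ} {E : Fin n → Type*} [∀ i, MeasurableSpace (E i)]
    (μ ν : ∀ i, Measure (E i)) [∀ i, SigmaFinite (μ i)] [∀ i, SigmaFinite (ν i)]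
    (f : ∀ i, E i → ENNReal) (hf : ∀ i, Measurable (f i))
    (h : ∀ i, ν i = (μ i).withDensity (f i)) :
    Measure.pi ν = (Measure.pi μ).withDensity fun x => ∏ i, f i (x i) := by
  refine Measure.pi_eq fun s hs => ?_
  rw [withDensity_apply _ (MeasurableSet.univ_pi hs), Measure.restrict_pi_pi,
    lintegral_pi_fin_prod _ _ hf]
  exact Finset.prod_congr rfl fun i _ => by rw [h, withDensity_apply _ (hs i)]

theorem pi_smul_fin {n : ℕ} {E : Fin n → Type*} [∀ i, MeasurableSpace (E i)]
    (μ : ∀ i, Measure (E i)) [∀ i, IsFiniteMeasure (μ i)] (c : Fin n → ENNReal)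
    (hc : ∀ i, c i ≠ ⊤) :
    Measure.pi (fun i => c i • μ i) = (∏ i, c i) • Measure.pi μ := by
  have (i : Fin n) : IsFiniteMeasure (c i • μ i) := Measure.smul_finite _ (hc i)
  refine Measure.pi_eq fun s hs => ?_
  simp [Measure.pi_pi, Finset.prod_mul_distrib]

theorem stdGaussian_eq_withDensity (d : ℕ) : ∃ c : ℝ, 0 < c ∧
    stdGaussian (EuclideanSpace ℝ (Fin d))
      = volume.withDensity fun x => ENNReal.ofReal (c * Real.exp (-(1 / 2) * ‖x‖ ^ 2)) := by
  refine ⟨((√(2 * Real.pi * (1 : NNReal)))⁻¹) ^ d, by positivity, ?_⟩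
  rw [← map_pi_eq_stdGaussian, pi_eq_withDensity_fin (fun _ => volume) _
    (fun _ => gaussianPDF 0 1) (fun _ => measurable_gaussianPDF 0 1)
    fun _ => gaussianReal_of_var_ne_zero 0 one_ne_zero]
  have hmp := PiLp.volume_preserving_toLp (Fin d)
  ext s hs
  rw [Measure.map_apply (by fun_prop) hs, withDensity_apply _ (hmp.measurable hs),
    withDensity_apply _ hs, ← hmp.setLIntegral_comp_preimage hs (by fun_prop)]
  refine lintegral_congr fun x => ?_
  simp only [gaussianPDF]
  rw [← ENNReal.ofReal_prod_of_nonneg fun i _ => gaussianPDFReal_nonneg _ _ _]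
  congr 1
  simp only [gaussianPDFReal, Finset.prod_mul_distrib, Finset.prod_const, Finset.card_univ,
    Fintype.card_fin, ← Real.exp_sum, EuclideanSpace.real_norm_sq_eq, Finset.mul_sum]
  congr 2
  refine Finset.sum_congr rfl fun i _ => ?_
  simp
  ring

section EuclideanLin
variable {k l m : ℕ}

theorem toEuclideanLin_mul_apply (M : Matrix (Fin k) (Fin l) ℝ) (N : Matrix (Fin l) (Fin m) ℝ)
    (x : EuclideanSpace ℝ (Fin m)) :
    Matrix.toEuclideanLin (M * N) x = Matrix.toEuclideanLin M (Matrix.toEuclideanLin N x) := by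
  simp [Matrix.toLpLin_apply, Matrix.mulVec_mulVec]

theorem toEuclideanLin_one_apply (x : EuclideanSpace ℝ (Fin m)) :
    Matrix.toEuclideanLin (1 : Matrix (Fin m) (Fin m) ℝ) x = x := by
  simp

theorem inner_toEuclideanLin_left (M : Matrix (Fin k) (Fin l) ℝ) (x : EuclideanSpace ℝ (Fin l))
    (y : EuclideanSpace ℝ (Fin k)) :
    inner ℝ (Matrix.toEuclideanLin M x) y = inner ℝ x (Matrix.toEuclideanLin M.transpose y) := by
  have h := Matrix.toEuclideanLin_conjTranspose_eq_adjoint M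
  rw [Matrix.conjTranspose_eq_transpose_of_trivial] at h
  rw [h, LinearMap.adjoint_inner_right]

theorem inner_toEuclideanLin_symm {M : Matrix (Fin k) (Fin k) ℝ} (hM : M.IsHermitian)
    (x y : EuclideanSpace ℝ (Fin k)) :
    inner ℝ (Matrix.toEuclideanLin M x) y = inner ℝ x (Matrix.toEuclideanLin M y) := by
  rw [inner_toEuclideanLin_left, ← Matrix.conjTranspose_eq_transpose_of_trivial, hM.eq]

@[fun_prop]
theorem measurable_toEuclideanLin (M : Matrix (Fin k) (Fin l) ℝ) :
    Measurable (Matrix.toEuclideanLin M) :=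
  (LinearMap.continuous_of_finiteDimensional _).measurable

end EuclideanLin

theorem map_withDensity_comp {α β : Type*} [MeasurableSpace α] [MeasurableSpace β]
    (μ : Measure α) {e : α → β} (he : Measurable e) {h : β → ENNReal} (hh : Measurable h) :
    (μ.withDensity fun x => h (e x)).map e = (μ.map e).withDensity h := by
  ext s hs
  rw [Measure.map_apply he hs, withDensity_apply _ (he hs), withDensity_apply _ hs,
    setLIntegral_map hs hh he]

-- Change of variables from the standard Gaussian along x ↦ m + S^{1/2} x. The constant is chosen
-- before `m`: later `m` is W_a z, and no dependence on z may hide in the normalization.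
open scoped MatrixOrder in
theorem multivariateGaussian_eq_withDensity {d : ℕ} {S : Matrix (Fin d) (Fin d) ℝ}
    (hS : S.PosDef) : ∃ c : ℝ, 0 < c ∧ ∀ m : EuclideanSpace ℝ (Fin d),
    multivariateGaussian m S = volume.withDensity fun x => ENNReal.ofReal
      (c * Real.exp (-(1 / 2) * inner ℝ (x - m) (Matrix.toEuclideanLin S⁻¹ (x - m)))) := by
  obtain ⟨c, hc, hstd⟩ := stdGaussian_eq_withDensity d
  set r := CFC.sqrt S with hr
  have hrr : r * r = S := CFC.sqrt_mul_sqrt_self _ hS.posSemidef.nonneg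
  have hrs : r.IsHermitian := (CFC.sqrt_nonneg S).isSelfAdjoint
  have hdetS : S.det ≠ 0 := hS.det_pos.ne'
  have hdet : r.det ≠ 0 := fun h => hdetS (by rw [← hrr, Matrix.det_mul, h, mul_zero])
  have hru : IsUnit r.det := isUnit_iff_ne_zero.mpr hdet
  have hsand : r * S⁻¹ * r = 1 := by
    rw [← hrr, Matrix.mul_inv_rev, ← Matrix.mul_assoc, Matrix.mul_nonsing_inv _ hru,
      Matrix.one_mul, Matrix.nonsing_inv_mul _ hru]
  have hdetL : LinearMap.det (Matrix.toEuclideanLin r) ≠ 0 := by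
    change LinearMap.det (Matrix.toLpLin 2 2 r) ≠ 0
    rw [Matrix.toLpLin_eq_toLin, LinearMap.det_toLin]
    exact hdet
  set D := |(LinearMap.det (Matrix.toEuclideanLin r))⁻¹| with hD
  have hDpos : 0 < D := abs_pos.mpr (inv_ne_zero hdetL)
  -- `D` is the Jacobian factor of the affine map, `c` the constant of the standard Gaussian.
  refine ⟨D * c, by positivity, fun m => ?_⟩
  have he : Measurable fun x : EuclideanSpace ℝ (Fin d) => m + Matrix.toEuclideanLin r x := by
    fun_prop
  have hvol : (volume : Measure (EuclideanSpace ℝ (Fin d))).map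
      (fun x => m + Matrix.toEuclideanLin r x) = ENNReal.ofReal D • volume := by
    have h := Measure.map_map (μ := (volume : Measure (EuclideanSpace ℝ (Fin d))))
      (measurable_const_add m) (measurable_toEuclideanLin r)
    rw [Measure.map_linearMap_addHaar_eq_smul_addHaar _ hdetL, Measure.map_smul,
      map_add_left_eq_self] at h
    exact h.symm
  set h : EuclideanSpace ℝ (Fin d) → ENNReal := fun x => ENNReal.ofReal
    (c * Real.exp (-(1 / 2) * inner ℝ (x - m) (Matrix.toEuclideanLin S⁻¹ (x - m)))) with hh
  have hhm : Measurable h := by fun_prop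
  have hcomp : ∀ x, ENNReal.ofReal (c * Real.exp (-(1 / 2) * ‖x‖ ^ 2))
      = h (m + Matrix.toEuclideanLin r x) := fun x => by
    simp only [hh, add_sub_cancel_left]
    rw [inner_toEuclideanLin_symm hrs, ← toEuclideanLin_mul_apply, ← toEuclideanLin_mul_apply,
      hsand, toEuclideanLin_one_apply, real_inner_self_eq_norm_sq]
  have key : multivariateGaussian m S = (stdGaussian (EuclideanSpace ℝ (Fin d))).map
      (fun x => m + Matrix.toEuclideanLin r x) := rfl
  rw [key, hstd]
  simp_rw [hcomp]
  rw [map_withDensity_comp _ he hhm, hvol, withDensity_smul_measure,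
    ← withDensity_smul _ hhm]
  congr 1
  ext x
  simp only [Pi.smul_apply, smul_eq_mul, hh]
  rw [← ENNReal.ofReal_mul hDpos.le, mul_assoc]

/-- Reweighting a Gaussian by the exponential of a concave quadratic function yields a multiple of
a Gaussian. -/
theorem multivariateGaussian_withDensity_exp {d : ℕ} {S G : Matrix (Fin d) (Fin d) ℝ}
    (hS : S.PosDef) (hG : G.PosSemidef) : ∃ c : ℝ, 0 < c ∧ ∀ m b : EuclideanSpace ℝ (Fin d),
    (multivariateGaussian m S).withDensity (fun x => ENNReal.ofReal
        (Real.exp (-(1 / 2) * inner ℝ x (Matrix.toEuclideanLin G x) + inner ℝ b x)))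
      = ENNReal.ofReal (c * Real.exp
          (1 / 2 * inner ℝ (b + Matrix.toEuclideanLin S⁻¹ m)
              (Matrix.toEuclideanLin (G + S⁻¹)⁻¹ (b + Matrix.toEuclideanLin S⁻¹ m))
            - 1 / 2 * inner ℝ m (Matrix.toEuclideanLin S⁻¹ m))) •
        multivariateGaussian (Matrix.toEuclideanLin (G + S⁻¹)⁻¹ (b + Matrix.toEuclideanLin S⁻¹ m))
          (G + S⁻¹)⁻¹ := by
  have hP : S⁻¹.PosDef := hS.inv
  have hH : (G + S⁻¹).PosDef := hP.posSemidef_add hG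
  obtain ⟨c₁, hc₁, h₁⟩ := multivariateGaussian_eq_withDensity hS
  obtain ⟨c₂, hc₂, h₂⟩ := multivariateGaussian_eq_withDensity hH.inv
  -- The ratio of the two normalizing constants involves neither `m` nor `b`; all dependence on them
  -- stays in the explicit exponent.
  refine ⟨c₁ / c₂, by positivity, fun m b => ?_⟩
  rw [h₁, h₂, ← withDensity_mul _ (by fun_prop) (by fun_prop), ← withDensity_smul _ (by fun_prop)]
  congr 1
  ext x
  have hu : IsUnit (G + S⁻¹).det := isUnit_iff_ne_zero.mpr hH.det_pos.ne'
  rw [Matrix.nonsing_inv_nonsing_inv _ hu]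
  set q := b + Matrix.toEuclideanLin S⁻¹ m with hq
  set μ := Matrix.toEuclideanLin (G + S⁻¹)⁻¹ q with hμ
  have hHμ : Matrix.toEuclideanLin (G + S⁻¹) μ = q := by
    rw [hμ, ← toEuclideanLin_mul_apply, Matrix.mul_nonsing_inv _ hu, toEuclideanLin_one_apply]
  simp only [Pi.mul_apply, Pi.smul_apply, smul_eq_mul]
  rw [← ENNReal.ofReal_mul (by positivity), ← ENNReal.ofReal_mul (by positivity)]
  congr 1
  rw [mul_assoc, ← Real.exp_add, mul_mul_mul_comm, ← Real.exp_add, div_mul_cancel₀ _ hc₂.ne']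
  congr 2
  -- Completing the square: the terms linear in x agree because `μ` solves (G + S⁻¹) μ = q.
  have e1 : inner ℝ (x - m) (Matrix.toEuclideanLin S⁻¹ (x - m))
      = inner ℝ x (Matrix.toEuclideanLin S⁻¹ x) - 2 * inner ℝ x (Matrix.toEuclideanLin S⁻¹ m)
        + inner ℝ m (Matrix.toEuclideanLin S⁻¹ m) := by
    simp only [map_sub, inner_sub_left, inner_sub_right]
    rw [← inner_toEuclideanLin_symm hP.isHermitian m x,
      real_inner_comm x (Matrix.toEuclideanLin S⁻¹ m)]
    ring
  have e2 : inner ℝ (x - μ) (Matrix.toEuclideanLin (G + S⁻¹) (x - μ))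
      = inner ℝ x (Matrix.toEuclideanLin G x) + inner ℝ x (Matrix.toEuclideanLin S⁻¹ x)
        - 2 * inner ℝ x q + inner ℝ μ q := by
    simp only [map_sub, inner_sub_left, inner_sub_right]
    rw [← inner_toEuclideanLin_symm hH.isHermitian μ x, hHμ, real_inner_comm x q, map_add,
      LinearMap.add_apply, inner_add_right]
    ring
  rw [e1, e2, real_inner_comm q μ, hq, inner_add_right, real_inner_comm x b]
  ring

/-! ### Kernels, Bayes' rule and Gaussian mixtures -/

open scoped MatrixOrder in
/-- The kernel `z ↦ N(f z, S)` for a measurable mean `f`. -/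
def gaussianKernel {α : Type*} [MeasurableSpace α] {d : ℕ} (f : α → EuclideanSpace ℝ (Fin d))
    (hf : Measurable f) (S : Matrix (Fin d) (Fin d) ℝ) : Kernel α (EuclideanSpace ℝ (Fin d)) where
  toFun z := multivariateGaussian (f z) S
  measurable' := by
    refine Measure.measurable_of_measurable_coe _ fun s hs => ?_
    -- The mass of `s` at `z` is the standard Gaussian mass of the section at `z` of a jointly
    -- measurable preimage of `s`.
    have h2 : Measurable fun p : α × EuclideanSpace ℝ (Fin d) =>
        f p.1 + Matrix.toEuclideanCLM (𝕜 := ℝ) (CFC.sqrt S) p.2 := by fun_prop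
    have h3 := measurable_measure_prodMk_left (ν := stdGaussian (EuclideanSpace ℝ (Fin d))) (h2 hs)
    convert h3 using 2 with z
    rw [multivariateGaussian, Measure.map_apply (by fun_prop) hs]
    rfl

instance {α : Type*} [MeasurableSpace α] {d : ℕ} (f : α → EuclideanSpace ℝ (Fin d))
    (hf : Measurable f) (S : Matrix (Fin d) (Fin d) ℝ) : IsMarkovKernel (gaussianKernel f hf S) :=
  ⟨fun z => inferInstanceAs (IsProbabilityMeasure (multivariateGaussian (f z) S))⟩

/-- The product of a finite family of Markov kernels on the same space. -/
def piKernel {α ι : Type*} [MeasurableSpace α] [Fintype ι] {E : ι → Type*}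
    [∀ i, MeasurableSpace (E i)] (κ : ∀ i, Kernel α (E i)) [∀ i, IsMarkovKernel (κ i)] :
    Kernel α (∀ i, E i) where
  toFun z := Measure.pi fun i => κ i z
  measurable' := by
    refine .measure_of_isPiSystem_of_isProbabilityMeasure generateFrom_pi.symm isPiSystem_pi ?_
    rintro _ ⟨s, hs, rfl⟩
    simp_rw [Measure.pi_pi]
    exact Finset.measurable_prod _ fun i _ => (κ i).measurable_coe (hs i (Set.mem_univ i))

instance {α ι : Type*} [MeasurableSpace α] [Fintype ι] {E : ι → Type*}
    [∀ i, MeasurableSpace (E i)] (κ : ∀ i, Kernel α (E i)) [∀ i, IsMarkovKernel (κ i)] :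
    IsMarkovKernel (piKernel κ) :=
  ⟨fun z => inferInstanceAs (IsProbabilityMeasure (Measure.pi fun i => κ i z))⟩

theorem compProd_eq_withDensity_compProd {α β : Type*} [MeasurableSpace α] [MeasurableSpace β]
    (ρ : Measure α) [SFinite ρ] (η κ : Kernel α β) [IsSFiniteKernel η] [IsSFiniteKernel κ]
    {g : α → ENNReal} (hg : Measurable g) (h : ∀ x, η x = g x • κ x) :
    ρ ⊗ₘ η = (ρ.withDensity g) ⊗ₘ κ := by
  ext s hs
  rw [Measure.compProd_apply hs, Measure.compProd_apply hs,
    lintegral_withDensity_eq_lintegral_mul _ hg (Kernel.measurable_kernel_prodMk_left hs)]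
  exact lintegral_congr fun x => by simp [h]

/-- **Bayes' rule**: a conditional law can be read off a disintegration of the joint law up to
normalization. -/
theorem condDistrib_ae_eq_of_map_eq_compProd {Ω α β : Type*} [MeasurableSpace Ω]
    [MeasurableSpace α] [MeasurableSpace β] [StandardBorelSpace β] [Nonempty β]
    {P : Measure Ω} [IsFiniteMeasure P] {X : Ω → α} {Y : Ω → β} (hY : Measurable Y)
    {ρ : Measure α} [SFinite ρ] (η : Kernel α β) [IsSFiniteKernel η]
    (hlaw : P.map (fun ω => (X ω, Y ω)) = ρ ⊗ₘ η)
    (post : α → Measure β) [∀ x, IsProbabilityMeasure (post x)]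
    (hpost : ∀ x, ∃ c : ENNReal, c ≠ 0 ∧ c ≠ ⊤ ∧ η x = c • post x) :
    ∀ᵐ x ∂P.map X, condDistrib Y X P x = post x := by
  choose g hg0 hgt hη using hpost
  -- The normalizer is the total mass of `η x`, hence measurable in x; dividing by it makes `post` a
  -- kernel.
  have hgη : g = fun x => η x Set.univ := by ext x; simp [hη]
  have hg : Measurable g := hgη ▸ η.measurable_coe MeasurableSet.univ
  let κ : Kernel α β :=
    { toFun := post
      measurable' := by
        refine Measure.measurable_of_measurable_coe _ fun s hs => ?_
        convert hg.inv.mul (η.measurable_coe hs) using 2 with x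
        simp [hη, ← mul_assoc, ENNReal.inv_mul_cancel (hg0 x) (hgt x)] }
  have : IsMarkovKernel κ := ⟨fun x => inferInstanceAs (IsProbabilityMeasure (post x))⟩
  -- Once the normalizer is absorbed into the base measure, the latter must be the law of `X`, and
  -- uniqueness of disintegrations applies.
  rw [compProd_eq_withDensity_compProd ρ η κ hg hη] at hlaw
  have hX : P.map X = ρ.withDensity g := by
    rw [← Measure.fst_map_prodMk hY, hlaw, Measure.fst_compProd]
  rw [← hX] at hlaw
  exact condDistrib_ae_eq_of_measure_eq_compProd X hY.aemeasurable hlaw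

/-- Tonelli. It moves an independent factor (the design, later the sample) to the conditioning side,
where the kernel ignores it. -/
theorem map_prod_compProd {α β γ : Type*} [MeasurableSpace α] [MeasurableSpace β]
    [MeasurableSpace γ] (ρ : Measure α) [SFinite ρ] (μ : Measure β) [SFinite μ] (κ : Kernel β γ)
    [IsSFiniteKernel κ] :
    (ρ.prod (μ ⊗ₘ κ)).map (fun q => ((q.2.1, q.1), q.2.2))
      = (μ.prod ρ) ⊗ₘ (κ.comap Prod.fst measurable_fst) := by
  refine Measure.ext_of_lintegral _ fun f hf => ?_
  have hm : Measurable fun p : β × α => ∫⁻ t, f (p, t) ∂κ p.1 :=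
    hf.lintegral_kernel_prod_right' (κ := κ.comap Prod.fst measurable_fst)
  rw [lintegral_map hf (by fun_prop), lintegral_prod _ (by fun_prop),
    Measure.lintegral_compProd hf]
  simp only [Kernel.comap_apply]
  rw [lintegral_prod_symm _ hm.aemeasurable]
  refine lintegral_congr fun x => ?_
  rw [Measure.lintegral_compProd (by fun_prop)]

theorem conj_posSemidef {k l : ℕ} {S : Matrix (Fin k) (Fin k) ℝ} (hS : S.PosSemidef)
    (M : Matrix (Fin l) (Fin k) ℝ) : (M * S * M.transpose).PosSemidef := by
  simpa using hS.mul_mul_conjTranspose_same M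

/-- The mixture of the Gaussians `N(M z + b, C)` over a Gaussian `z` is Gaussian. -/
theorem bind_multivariateGaussian {k d : ℕ} {S : Matrix (Fin k) (Fin k) ℝ} (hS : S.PosSemidef)
    {C : Matrix (Fin d) (Fin d) ℝ} (hC : C.PosSemidef) (m : EuclideanSpace ℝ (Fin k))
    (M : Matrix (Fin d) (Fin k) ℝ) (b : EuclideanSpace ℝ (Fin d))
    (κ : Kernel (EuclideanSpace ℝ (Fin k)) (EuclideanSpace ℝ (Fin d))) [IsMarkovKernel κ]
    (hκ : ∀ z, κ z = multivariateGaussian (b + Matrix.toEuclideanLin M z) C) :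
    (multivariateGaussian m S ⊗ₘ κ).snd
      = multivariateGaussian (b + Matrix.toEuclideanLin M m) (C + M * S * M.transpose) := by
  refine Measure.ext_of_charFun (funext fun t => ?_)
  rw [charFun_multivariateGaussian (hC.add (conj_posSemidef hS M)), charFun_apply, Measure.snd,
    integral_map (by fun_prop) (by fun_prop), Measure.integral_compProd]
  · simp only [hκ, ← charFun_apply, charFun_multivariateGaussian hC]
    -- Characteristic functions: only the last factor depends on z, and its integral is the
    -- characteristic function of the mixing Gaussian at Mᵀ t.
    have hsplit : ∀ z : EuclideanSpace ℝ (Fin k),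
        Complex.exp (inner ℝ t (b + Matrix.toEuclideanLin M z) * Complex.I
            - (t.ofLp ⬝ᵥ C.mulVec t.ofLp : ℝ) / 2)
          = Complex.exp (inner ℝ t b * Complex.I - (t.ofLp ⬝ᵥ C.mulVec t.ofLp : ℝ) / 2)
            * Complex.exp (inner ℝ z (Matrix.toEuclideanLin M.transpose t) * Complex.I) :=
        fun z => by
      rw [← Complex.exp_add, inner_add_right, real_inner_comm (Matrix.toEuclideanLin M z) t,
        inner_toEuclideanLin_left]
      push_cast
      ring_nf
    simp_rw [hsplit]
    rw [integral_const_mul, ← charFun_apply, charFun_multivariateGaussian hS, ← Complex.exp_add,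
      inner_add_right, inner_toEuclideanLin_left, Matrix.transpose_transpose]
    congr 1
    have e : t.ofLp ⬝ᵥ (C + M * S * M.transpose).mulVec t.ofLp = t.ofLp ⬝ᵥ C.mulVec t.ofLp
        + (M.transpose.mulVec t.ofLp) ⬝ᵥ S.mulVec (M.transpose.mulVec t.ofLp) := by
      rw [Matrix.add_mulVec, dotProduct_add, ← Matrix.mulVec_mulVec, ← Matrix.mulVec_mulVec,
        Matrix.dotProduct_mulVec _ M, ← Matrix.mulVec_transpose]
    rw [e]
    simp only [Matrix.ofLp_toLpLin, Matrix.toLin'_apply]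
    push_cast
    ring
  · refine Integrable.of_bound (by fun_prop) 1 (ae_of_all _ fun x => ?_)
    rw [Complex.norm_exp_ofReal_mul_I]

/-! ### Positivity of the posterior matrices and the likelihood of a sample -/

namespace HierParams

variable {𝒳 : Type*} {d d' K n : ℕ} (p : HierParams 𝒳 d d' K)

theorem posSemidef_G (s : Fin n → 𝒳 × Fin K × ℝ) (a : Fin K) : (p.G s a).PosSemidef := by
  refine Matrix.PosSemidef.smul (Matrix.posSemidef_sum _ fun i _ => ?_) (by positivity)
  simpa using Matrix.posSemidef_vecMulVec_self_star (p.φ (s i).1).ofLp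

theorem posDef_actPrec (hA : ∀ a, (p.actCov a).PosDef) (s : Fin n → 𝒳 × Fin K × ℝ) (a : Fin K) :
    (p.G s a + (p.actCov a)⁻¹).PosDef :=
  (hA a).inv.posSemidef_add (p.posSemidef_G s a)

theorem posDef_condPostCov (hA : ∀ a, (p.actCov a).PosDef) (s : Fin n → 𝒳 × Fin K × ℝ)
    (a : Fin K) : (p.condPostCov s a).PosDef :=
  (p.posDef_actPrec hA s a).inv

/-- The information matrix of the sample about the latent parameter. -/
def latInfo (s : Fin n → 𝒳 × Fin K × ℝ) : Matrix (Fin d') (Fin d') ℝ :=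
  ∑ a, (p.W a).transpose *
    ((p.actCov a)⁻¹ - (p.actCov a)⁻¹ * (p.G s a + (p.actCov a)⁻¹)⁻¹ * (p.actCov a)⁻¹) * p.W a

/-- The linear statistic of the sample that informs about the latent parameter. -/
def latStat (s : Fin n → 𝒳 × Fin K × ℝ) : EuclideanSpace ℝ (Fin d') :=
  ∑ a, Matrix.toEuclideanLin
    ((p.W a).transpose * (p.actCov a)⁻¹ * (p.G s a + (p.actCov a)⁻¹)⁻¹) (p.B s a)

end HierParams

theorem _root_.Measurable.gaussianPDF {α : Type*} [MeasurableSpace α] {m y : α → ℝ}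
    (hm : Measurable m) (hy : Measurable y) (v : NNReal) :
    Measurable fun x => gaussianPDF (m x) v (y x) := by
  unfold ProbabilityTheory.gaussianPDF gaussianPDFReal
  fun_prop

/-- With T = (G + S)⁻¹ S the matrix equals (1 - T)ᵀ S (1 - T) + Tᵀ G T. This does not invert G,
which is singular when an action has few samples. -/
theorem posSemidef_sub_mul_inv_mul {k : ℕ} {G S : Matrix (Fin k) (Fin k) ℝ}
    (hG : G.PosSemidef) (hS : S.PosDef) : (S - S * (G + S)⁻¹ * S).PosSemidef := by
  have hH : (G + S).PosDef := hS.posSemidef_add hG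
  have hu : IsUnit (G + S).det := isUnit_iff_ne_zero.mpr hH.det_pos.ne'
  have hSt : S.transpose = S := by simpa using hS.isHermitian.eq
  have hHt : (G + S)⁻¹.transpose = (G + S)⁻¹ := by simpa using hH.inv.isHermitian.eq
  set T := (G + S)⁻¹ * S with hT
  have hTt : T.transpose = S * (G + S)⁻¹ := by rw [hT, Matrix.transpose_mul, hSt, hHt]
  have hGT : (G + S) * T = S := Matrix.mul_nonsing_inv_cancel_left _ _ hu
  have key : S - S * (G + S)⁻¹ * S = (1 - T).transpose * S * (1 - T).transpose.transpose
      + T.transpose * G * T.transpose.transpose := by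
    have h1 : G * T = S - S * T := by rw [eq_sub_iff_add_eq, ← Matrix.add_mul, hGT]
    rw [Matrix.transpose_transpose, Matrix.transpose_transpose, Matrix.transpose_sub,
      Matrix.transpose_one, Matrix.mul_assoc T.transpose G, h1, Matrix.mul_assoc S, ← hT]
    noncomm_ring
  rw [key]
  exact (conj_posSemidef hS.posSemidef _).add (conj_posSemidef hG _)

namespace HierParams

variable {𝒳 : Type*} {d d' K n : ℕ} (p : HierParams 𝒳 d d' K)

theorem posSemidef_latInfo (hA : ∀ a, (p.actCov a).PosDef) (s : Fin n → 𝒳 × Fin K × ℝ) :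
    (p.latInfo s).PosSemidef := by
  refine Matrix.posSemidef_sum _ fun a _ => ?_
  simpa using conj_posSemidef (posSemidef_sub_mul_inv_mul (p.posSemidef_G s a) (hA a).inv)
    (p.W a).transpose

theorem latPostPrec_eq (s : Fin n → 𝒳 × Fin K × ℝ) :
    p.latPostPrec s = p.latInfo s + p.latCov⁻¹ := add_comm _ _

theorem latPostMean_eq (s : Fin n → 𝒳 × Fin K × ℝ) :
    p.latPostMean s = Matrix.toEuclideanLin (p.latInfo s + p.latCov⁻¹)⁻¹
      (p.latStat s + Matrix.toEuclideanLin p.latCov⁻¹ p.latMean) := by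
  rw [← latPostPrec_eq, add_comm]
  rfl

theorem posDef_latPostPrec (hL : p.latCov.PosDef) (hA : ∀ a, (p.actCov a).PosDef)
    (s : Fin n → 𝒳 × Fin K × ℝ) : (p.latPostPrec s).PosDef :=
  p.latPostPrec_eq s ▸ hL.inv.posSemidef_add (p.posSemidef_latInfo hA s)

theorem margPostCov_eq (hA : ∀ a, (p.actCov a).PosDef) (s : Fin n → 𝒳 × Fin K × ℝ) (a : Fin K) :
    p.margPostCov s a = p.condPostCov s a
      + (p.condPostCov s a * (p.actCov a)⁻¹ * p.W a) * p.latPostCov s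
        * (p.condPostCov s a * (p.actCov a)⁻¹ * p.W a).transpose := by
  have h1 : (p.actCov a)⁻¹.transpose = (p.actCov a)⁻¹ := by simpa using (hA a).inv.isHermitian.eq
  have h2 : (p.condPostCov s a).transpose = p.condPostCov s a := by
    simpa using (p.posDef_condPostCov hA s a).isHermitian.eq
  rw [Matrix.transpose_mul, Matrix.transpose_mul, h1, h2]
  simp only [margPostCov, Matrix.mul_assoc]

theorem posDef_margPostCov (hL : p.latCov.PosDef) (hA : ∀ a, (p.actCov a).PosDef)
    (s : Fin n → 𝒳 × Fin K × ℝ) (a : Fin K) : (p.margPostCov s a).PosDef :=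
  p.margPostCov_eq hA s a ▸ (p.posDef_condPostCov hA s a).add_posSemidef
    (conj_posSemidef (p.posDef_latPostPrec hL hA s).inv.posSemidef _)

theorem condPostMean_eq (s : Fin n → 𝒳 × Fin K × ℝ) (a : Fin K) (z : EuclideanSpace ℝ (Fin d')) :
    p.condPostMean s a z = Matrix.toEuclideanLin (p.condPostCov s a) (p.B s a)
      + Matrix.toEuclideanLin (p.condPostCov s a * (p.actCov a)⁻¹ * p.W a) z := by
  rw [condPostMean, map_add, Matrix.mul_assoc, ← toEuclideanLin_mul_apply]

/-- The likelihood of the action parameters `t` under the sample `s`. -/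
def likelihood (s : Fin n → 𝒳 × Fin K × ℝ) (t : Fin K → EuclideanSpace ℝ (Fin d)) : ENNReal :=
  ∏ i, gaussianPDF (inner ℝ (p.φ (s i).1) (t (s i).2.1)) (p.σ ^ 2).toNNReal (s i).2.2

theorem measurable_likelihood [MeasurableSpace 𝒳] (hφ : Measurable p.φ) {α : Type*}
    [MeasurableSpace α] {f : α → Fin n → 𝒳 × Fin K × ℝ} {g : α → Fin K → EuclideanSpace ℝ (Fin d)}
    (hf : Measurable f) (hg : Measurable g) : Measurable fun x => p.likelihood (f x) (g x) := by
  -- Evaluating the parameters at a varying action is jointly measurable because there are only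
  -- countably many actions.
  have hev : Measurable fun q : Fin K × (Fin K → EuclideanSpace ℝ (Fin d)) => q.2 q.1 :=
    measurable_from_prod_countable_right fun a => measurable_pi_apply a
  refine Finset.measurable_prod _ fun i _ => ?_
  have hm : Measurable fun x => g x (f x i).2.1 :=
    hev.comp (f := fun x => ((f x i).2.1, g x)) (by fun_prop)
  exact (Measurable.inner (by fun_prop) hm).gaussianPDF (by fun_prop) _

theorem inner_G (s : Fin n → 𝒳 × Fin K × ℝ) (a : Fin K) (x : EuclideanSpace ℝ (Fin d)) :
    inner ℝ x (Matrix.toEuclideanLin (p.G s a) x)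
      = (p.σ ^ 2)⁻¹ * ∑ i with (s i).2.1 = a, inner ℝ (p.φ (s i).1) x ^ 2 := by
  rw [G, map_smul, map_sum, LinearMap.smul_apply, LinearMap.sum_apply, inner_smul_right, inner_sum]
  congr 1
  refine Finset.sum_congr rfl fun i _ => ?_
  rw [Matrix.toLpLin_apply, Matrix.vecMulVec_mulVec, real_inner_comm x, sq]
  simp [EuclideanSpace.inner_eq_star_dotProduct, dotProduct_comm]

theorem inner_B (s : Fin n → 𝒳 × Fin K × ℝ) (a : Fin K) (x : EuclideanSpace ℝ (Fin d)) :
    inner ℝ (p.B s a) x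
      = (p.σ ^ 2)⁻¹ * ∑ i with (s i).2.1 = a, (s i).2.2 * inner ℝ (p.φ (s i).1) x := by
  simp [B, inner_smul_left, sum_inner]

/-- Expand each square (r - ⟨φ, t⟩)²: the r² terms and normalizations form the constant, and sorting
the samples by action turns the rest into `G` and `B`. The factorization over actions is the source
of the posterior independence of the θ_a. -/
theorem likelihood_eq (hσ : 0 < p.σ) (s : Fin n → 𝒳 × Fin K × ℝ) : ∃ c : ℝ, 0 < c ∧
    ∀ t : Fin K → EuclideanSpace ℝ (Fin d), p.likelihood s t = ENNReal.ofReal c *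
      ∏ a, ENNReal.ofReal (Real.exp (-(1 / 2) *
        inner ℝ (t a) (Matrix.toEuclideanLin (p.G s a) (t a)) + inner ℝ (p.B s a) (t a))) := by
  refine ⟨∏ i, (√(2 * Real.pi * p.σ ^ 2))⁻¹ * Real.exp (-(s i).2.2 ^ 2 / (2 * p.σ ^ 2)),
    Finset.prod_pos fun i _ => by positivity, fun t => ?_⟩
  rw [← ENNReal.ofReal_prod_of_nonneg fun a _ => (Real.exp_pos _).le,
    ← ENNReal.ofReal_mul (Finset.prod_nonneg fun i _ => by positivity), ← Real.exp_sum]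
  have hsum : ∑ a, (-(1 / 2) * inner ℝ (t a) (Matrix.toEuclideanLin (p.G s a) (t a))
      + inner ℝ (p.B s a) (t a))
      = ∑ i, (p.σ ^ 2)⁻¹ * (-(1 / 2) * inner ℝ (p.φ (s i).1) (t (s i).2.1) ^ 2
        + (s i).2.2 * inner ℝ (p.φ (s i).1) (t (s i).2.1)) := by
    rw [← Finset.sum_fiberwise (s := Finset.univ) (g := fun i => (s i).2.1)]
    refine Finset.sum_congr rfl fun a _ => ?_
    rw [inner_G, inner_B, mul_left_comm, ← mul_add, ← Finset.mul_sum, Finset.mul_sum,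
      ← Finset.sum_add_distrib]
    congr 1
    refine Finset.sum_congr rfl fun i hi => ?_
    rw [(Finset.mem_filter.mp hi).2]
  rw [hsum, Real.exp_sum, ← Finset.prod_mul_distrib]
  unfold likelihood gaussianPDF
  rw [← ENNReal.ofReal_prod_of_nonneg fun i _ => gaussianPDFReal_nonneg _ _ _]
  congr 1
  refine Finset.prod_congr rfl fun i _ => ?_
  rw [gaussianPDFReal, Real.coe_toNNReal _ (by positivity), mul_assoc (√(_))⁻¹, ← Real.exp_add]
  congr 2
  field_simp
  ring

end HierParams

/-! ### Conjugate updates of the action parameters and of the latent parameter -/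

namespace HierParams

variable {𝒳 : Type*} {d d' K n : ℕ} (p : HierParams 𝒳 d d' K)

@[fun_prop]
theorem measurable_condPostMean (s : Fin n → 𝒳 × Fin K × ℝ) (a : Fin K) :
    Measurable (p.condPostMean s a) := by
  unfold condPostMean
  fun_prop

/-- The conditional law of the action parameters given the latent parameter. -/
def priorKernel : Kernel (EuclideanSpace ℝ (Fin d')) (Fin K → EuclideanSpace ℝ (Fin d)) :=
  piKernel fun a => gaussianKernel (Matrix.toEuclideanLin (p.W a)) (by fun_prop) (p.actCov a)

instance : IsMarkovKernel p.priorKernel := by unfold priorKernel; infer_instance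

/-- The conditional law of the action parameters given the latent parameter and the sample. -/
def condPostKernel (s : Fin n → 𝒳 × Fin K × ℝ) :
    Kernel (EuclideanSpace ℝ (Fin d')) (Fin K → EuclideanSpace ℝ (Fin d)) :=
  piKernel fun a => gaussianKernel (p.condPostMean s a) (by fun_prop) (p.condPostCov s a)

instance (s : Fin n → 𝒳 × Fin K × ℝ) : IsMarkovKernel (p.condPostKernel s) := by
  unfold condPostKernel; infer_instance

theorem condPostKernel_apply (s : Fin n → 𝒳 × Fin K × ℝ) (z : EuclideanSpace ℝ (Fin d')) :
    p.condPostKernel s z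
      = Measure.pi fun a => multivariateGaussian (p.condPostMean s a z) (p.condPostCov s a) := rfl

/-- Each summand is -2 times the part quadratic in z of the exponent left by completing the square
with prior mean W_a z; `inner_latStat` matches the linear part. -/
theorem inner_latInfo (hA : ∀ a, (p.actCov a).PosDef) (s : Fin n → 𝒳 × Fin K × ℝ)
    (z : EuclideanSpace ℝ (Fin d')) :
    inner ℝ z (Matrix.toEuclideanLin (p.latInfo s) z) = ∑ a,
      (inner ℝ (Matrix.toEuclideanLin (p.W a) z)
          (Matrix.toEuclideanLin (p.actCov a)⁻¹ (Matrix.toEuclideanLin (p.W a) z))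
        - inner ℝ (Matrix.toEuclideanLin (p.actCov a)⁻¹ (Matrix.toEuclideanLin (p.W a) z))
            (Matrix.toEuclideanLin (p.G s a + (p.actCov a)⁻¹)⁻¹
              (Matrix.toEuclideanLin (p.actCov a)⁻¹ (Matrix.toEuclideanLin (p.W a) z)))) := by
  rw [latInfo, map_sum, LinearMap.sum_apply, inner_sum]
  refine Finset.sum_congr rfl fun a _ => ?_
  rw [Matrix.mul_assoc, toEuclideanLin_mul_apply, ← inner_toEuclideanLin_left,
    toEuclideanLin_mul_apply, map_sub, LinearMap.sub_apply, inner_sub_right, Matrix.mul_assoc,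
    toEuclideanLin_mul_apply, toEuclideanLin_mul_apply,
    ← inner_toEuclideanLin_symm (hA a).inv.isHermitian _
      (Matrix.toEuclideanLin (p.G s a + (p.actCov a)⁻¹)⁻¹ _)]

theorem inner_latStat (hA : ∀ a, (p.actCov a).PosDef) (s : Fin n → 𝒳 × Fin K × ℝ)
    (z : EuclideanSpace ℝ (Fin d')) :
    inner ℝ (p.latStat s) z = ∑ a, inner ℝ (p.B s a)
      (Matrix.toEuclideanLin (p.G s a + (p.actCov a)⁻¹)⁻¹
        (Matrix.toEuclideanLin (p.actCov a)⁻¹ (Matrix.toEuclideanLin (p.W a) z))) := by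
  rw [latStat, sum_inner]
  refine Finset.sum_congr rfl fun a _ => ?_
  rw [Matrix.mul_assoc, toEuclideanLin_mul_apply, inner_toEuclideanLin_left,
    Matrix.transpose_transpose, toEuclideanLin_mul_apply,
    inner_toEuclideanLin_symm (hA a).inv.isHermitian,
    inner_toEuclideanLin_symm (p.posDef_actPrec hA s a).inv.isHermitian]

/-- The update at the action level. The constant does not depend on z, so the exponential is, up to
scale, the likelihood of the latent parameter after integrating out θ. -/
theorem priorKernel_withDensity_likelihood (hσ : 0 < p.σ) (hA : ∀ a, (p.actCov a).PosDef)
    (s : Fin n → 𝒳 × Fin K × ℝ) : ∃ c : ℝ, 0 < c ∧ ∀ z : EuclideanSpace ℝ (Fin d'),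
    (p.priorKernel z).withDensity (p.likelihood s)
      = (ENNReal.ofReal c * ENNReal.ofReal (Real.exp (-(1 / 2) *
          inner ℝ z (Matrix.toEuclideanLin (p.latInfo s) z) + inner ℝ (p.latStat s) z))) •
        p.condPostKernel s z := by
  obtain ⟨c₀, hc₀, hlik⟩ := p.likelihood_eq hσ s
  choose c hc hN using fun a =>
    multivariateGaussian_withDensity_exp (hA a) (p.posSemidef_G s a)
  -- `k` collects what is free of z: the normalizing ratios and the terms quadratic in B_a.
  set k : ℝ := ∏ a, c a * Real.exp (1 / 2 * inner ℝ (p.B s a)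
    (Matrix.toEuclideanLin (p.G s a + (p.actCov a)⁻¹)⁻¹ (p.B s a))) with hk
  have hkpos : 0 < k := Finset.prod_pos fun a _ => mul_pos (hc a) (Real.exp_pos _)
  refine ⟨c₀ * k, by positivity, fun z => ?_⟩
  set f : Fin K → EuclideanSpace ℝ (Fin d) → ENNReal := fun a x => ENNReal.ofReal (Real.exp
    (-(1 / 2) * inner ℝ x (Matrix.toEuclideanLin (p.G s a) x) + inner ℝ (p.B s a) x)) with hf
  have hfm : ∀ a, Measurable (f a) := fun a => by fun_prop
  have hL : p.likelihood s = ENNReal.ofReal c₀ • fun t => ∏ a, f a (t a) := funext fun t => by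
    rw [hlik t]; rfl
  set g : Fin K → ℝ := fun a => c a * Real.exp
    (1 / 2 * inner ℝ (p.B s a + Matrix.toEuclideanLin (p.actCov a)⁻¹
        (Matrix.toEuclideanLin (p.W a) z))
      (Matrix.toEuclideanLin (p.G s a + (p.actCov a)⁻¹)⁻¹ (p.B s a +
        Matrix.toEuclideanLin (p.actCov a)⁻¹ (Matrix.toEuclideanLin (p.W a) z)))
      - 1 / 2 * inner ℝ (Matrix.toEuclideanLin (p.W a) z)
        (Matrix.toEuclideanLin (p.actCov a)⁻¹ (Matrix.toEuclideanLin (p.W a) z))) with hg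
  have hNa : ∀ a, ENNReal.ofReal (g a) •
        multivariateGaussian (p.condPostMean s a z) (p.condPostCov s a)
      = (multivariateGaussian (Matrix.toEuclideanLin (p.W a) z) (p.actCov a)).withDensity
          (f a) := fun a => by
    rw [hf, hN a, condPostMean, condPostCov, toEuclideanLin_mul_apply]
  have hfin (a : Fin K) : IsFiniteMeasure (ENNReal.ofReal (g a) •
      multivariateGaussian (p.condPostMean s a z) (p.condPostCov s a)) :=
    Measure.smul_finite _ ENNReal.ofReal_ne_top
  have hgk : ∏ a, g a = k * Real.exp (-(1 / 2) *
      inner ℝ z (Matrix.toEuclideanLin (p.latInfo s) z) + inner ℝ (p.latStat s) z) := by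
    rw [hg, hk, Finset.prod_mul_distrib, Finset.prod_mul_distrib, ← Real.exp_sum, ← Real.exp_sum,
      mul_assoc, ← Real.exp_add, p.inner_latInfo hA, p.inner_latStat hA, Finset.mul_sum,
      ← Finset.sum_add_distrib, ← Finset.sum_add_distrib]
    congr 2
    refine Finset.sum_congr rfl fun a _ => ?_
    simp only [map_add, inner_add_left, inner_add_right]
    have hcomm : ∀ y, inner ℝ y (Matrix.toEuclideanLin (p.G s a + (p.actCov a)⁻¹)⁻¹ (p.B s a))
        = inner ℝ (p.B s a) (Matrix.toEuclideanLin (p.G s a + (p.actCov a)⁻¹)⁻¹ y) := fun y => by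
      rw [← inner_toEuclideanLin_symm (p.posDef_actPrec hA s a).inv.isHermitian, real_inner_comm]
    rw [hcomm (Matrix.toEuclideanLin (p.actCov a)⁻¹ _)]
    ring
  have hpi := pi_eq_withDensity_fin _ _ f hfm hNa
  rw [pi_smul_fin _ _ fun _ => ENNReal.ofReal_ne_top] at hpi
  have hprod : Measurable fun t : Fin K → EuclideanSpace ℝ (Fin d) => ∏ a, f a (t a) :=
    Finset.measurable_prod _ fun a _ => (hfm a).comp (measurable_pi_apply a)
  rw [hL, withDensity_smul _ hprod, condPostKernel_apply, ENNReal.ofReal_mul hc₀.le, mul_assoc,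
    ← ENNReal.ofReal_mul hkpos.le, ← hgk, ENNReal.ofReal_prod_of_nonneg
      fun a _ => mul_nonneg (hc a).le (Real.exp_pos _).le, mul_smul, hpi]
  rfl

/-- The joint posterior law of the latent parameter and the action parameters. -/
def jointPost (s : Fin n → 𝒳 × Fin K × ℝ) :
    Measure (EuclideanSpace ℝ (Fin d') × (Fin K → EuclideanSpace ℝ (Fin d))) :=
  multivariateGaussian (p.latPostMean s) (p.latPostCov s) ⊗ₘ p.condPostKernel s

instance (s : Fin n → 𝒳 × Fin K × ℝ) : IsProbabilityMeasure (p.jointPost s) := by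
  unfold jointPost; infer_instance

theorem likelihood_ne_top (s : Fin n → 𝒳 × Fin K × ℝ) (t : Fin K → EuclideanSpace ℝ (Fin d)) :
    p.likelihood s t ≠ ⊤ :=
  ENNReal.prod_ne_top fun _ _ => ENNReal.ofReal_ne_top

/-- The update at the latent level: the factor in z left by the action level moves onto the prior of
ψ and is again the exponential of a concave quadratic. -/
theorem prior_withDensity_likelihood [MeasurableSpace 𝒳] (hφ : Measurable p.φ) (hσ : 0 < p.σ)
    (hL : p.latCov.PosDef) (hA : ∀ a, (p.actCov a).PosDef) (s : Fin n → 𝒳 × Fin K × ℝ) :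
    ∃ c : ENNReal, c ≠ 0 ∧ c ≠ ⊤ ∧
      (multivariateGaussian p.latMean p.latCov ⊗ₘ p.priorKernel).withDensity
        (fun q => p.likelihood s q.2) = c • p.jointPost s := by
  obtain ⟨c₁, hc₁, h₁⟩ := p.priorKernel_withDensity_likelihood hσ hA s
  obtain ⟨c₂, hc₂, h₂⟩ := multivariateGaussian_withDensity_exp hL (p.posSemidef_latInfo hA s)
  have hm' : Measurable (Function.uncurry fun (_ : EuclideanSpace ℝ (Fin d'))
    (t : Fin K → EuclideanSpace ℝ (Fin d)) => p.likelihood s t) :=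
    p.measurable_likelihood hφ measurable_const measurable_snd
  have : IsSFiniteKernel (p.priorKernel.withDensity fun _ t => p.likelihood s t) :=
    Kernel.IsSFiniteKernel.withDensity _ fun _ t => p.likelihood_ne_top s t
  set g : EuclideanSpace ℝ (Fin d') → ENNReal := fun z => ENNReal.ofReal (Real.exp (-(1 / 2) *
    inner ℝ z (Matrix.toEuclideanLin (p.latInfo s) z) + inner ℝ (p.latStat s) z)) with hg
  have hgm : Measurable g := by fun_prop
  obtain ⟨k, hk0, hkt, hk⟩ : ∃ k : ENNReal, k ≠ 0 ∧ k ≠ ⊤ ∧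
      (multivariateGaussian p.latMean p.latCov).withDensity g
        = k • multivariateGaussian (p.latPostMean s) (p.latPostCov s) := by
    have h₃ := h₂ p.latMean (p.latStat s)
    rw [← latPostMean_eq, ← latPostPrec_eq] at h₃
    exact ⟨_, (ENNReal.ofReal_pos.mpr (mul_pos hc₂ (Real.exp_pos _))).ne', ENNReal.ofReal_ne_top,
      h₃⟩
  refine ⟨ENNReal.ofReal c₁ * k, mul_ne_zero (ENNReal.ofReal_pos.mpr hc₁).ne' hk0,
    ENNReal.mul_ne_top ENNReal.ofReal_ne_top hkt, ?_⟩
  rw [← Measure.compProd_withDensity hm', compProd_eq_withDensity_compProd _ _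
    (p.condPostKernel s) (g := ENNReal.ofReal c₁ • g) (hgm.const_smul _)
    fun z => by rw [Kernel.withDensity_apply _ hm', h₁]; rfl, withDensity_smul _ hgm, hk,
    ← mul_smul, Measure.compProd_smul_left, jointPost]

end HierParams

/-! ### Joint law of the sample and the parameters -/

/-- The sample set assembled from the design and the rewards. -/
def assembleSample {𝒳 : Type*} {K n : ℕ} (q : (Fin n → 𝒳 × Fin K) × (Fin n → ℝ)) :
    Fin n → 𝒳 × Fin K × ℝ :=
  fun i => ((q.1 i).1, (q.1 i).2, q.2 i)

@[fun_prop]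
theorem measurable_assembleSample {𝒳 : Type*} [MeasurableSpace 𝒳] {K n : ℕ} :
    Measurable (assembleSample : (Fin n → 𝒳 × Fin K) × (Fin n → ℝ) → _) := by
  unfold assembleSample
  fun_prop

theorem map_prod_prod_rearrange {α β γ δ ε : Type*} [MeasurableSpace α] [MeasurableSpace β]
    [MeasurableSpace γ] [MeasurableSpace δ] [MeasurableSpace ε] (ν : Measure α) [SFinite ν]
    (π : Measure (β × γ)) [SFinite π] (v : Measure δ) [SFinite v] {e : α × δ → ε}
    (he : Measurable e) :
    ((((ν.prod π).map fun q => (q.2.1, q.2.2, q.1)).prod v).map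
        fun q => (e (q.1.2.2, q.2), (q.1.1, q.1.2.1)))
      = ((ν.prod v).map e).prod π := by
  have h1 := Measure.map_prod_map (ν.prod π) v
    (f := fun q : α × β × γ => (q.2.1, q.2.2, q.1)) (g := id) (by fun_prop) measurable_id
  have h2 := Measure.map_prod_map (ν.prod v) π he measurable_id
  rw [Measure.map_id] at h1 h2
  rw [h1, h2, Measure.map_map (by fun_prop) (by fun_prop)]
  refine Measure.ext_of_lintegral _ fun F hF => ?_
  rw [lintegral_map hF (by fun_prop), lintegral_map hF (by fun_prop),
    lintegral_prod _ (by fun_prop), lintegral_prod _ (by fun_prop),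
    lintegral_prod _ (by fun_prop), lintegral_prod _ (by fun_prop)]
  refine lintegral_congr fun x => ?_
  exact lintegral_lintegral_swap (Measurable.aemeasurable (by fun_prop))

namespace IsHierModel

variable {Ω 𝒳 : Type*} [MeasurableSpace Ω] [MeasurableSpace 𝒳] {d d' K n : ℕ}
  {p : HierParams 𝒳 d d' K} {P : Measure Ω} [IsProbabilityMeasure P]
  {ψ : Ω → EuclideanSpace ℝ (Fin d')} {θ : Fin K → Ω → EuclideanSpace ℝ (Fin d)}
  {X : Fin n → Ω → 𝒳} {A : Fin n → Ω → Fin K} {R : Fin n → Ω → ℝ}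

theorem measurable_design (hM : IsHierModel p P ψ θ X A R) :
    Measurable fun ω i => (X i ω, A i ω) :=
  measurable_pi_lambda _ fun i => (hM.meas_X i).prodMk (hM.meas_A i)

theorem measurable_params (hM : IsHierModel p P ψ θ X A R) :
    Measurable fun ω a => θ a ω :=
  measurable_pi_lambda _ hM.meas_action

theorem measurable_rewards (hM : IsHierModel p P ψ θ X A R) :
    Measurable fun ω i => R i ω :=
  measurable_pi_lambda _ hM.meas_R

theorem condDistrib_action (hM : IsHierModel p P ψ θ X A R) :
    ∀ᵐ z ∂P.map ψ, condDistrib (fun ω a => θ a ω) ψ P z = p.priorKernel z := by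
  filter_upwards [hM.action_indep, ae_all_iff.mpr hM.action_law] with z h1 h2
  rw [h1]
  simp only [h2]
  rfl

/-- Given ψ the design does not affect θ, and it is independent of ψ; chaining the two makes it
independent of the pair. -/
theorem map_design_params (hM : IsHierModel p P ψ θ X A R) :
    P.map (fun ω => ((fun i => (X i ω, A i ω)), (ψ ω, fun a => θ a ω)))
      = (P.map fun ω i => (X i ω, A i ω)).prod
        (multivariateGaussian p.latMean p.latCov ⊗ₘ p.priorKernel) := by
  have hD := hM.measurable_design
  have hT := hM.measurable_params
  have hψ := hM.meas_latent
  have h1 : P.map (fun ω => (ψ ω, fun i => (X i ω, A i ω)))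
      = (multivariateGaussian p.latMean p.latCov).prod (P.map fun ω i => (X i ω, A i ω)) := by
    rw [← hM.latent_law]
    exact (indepFun_iff_map_prod_eq_prod_map_map hψ.aemeasurable hD.aemeasurable).mp
      hM.design_indep_latent.symm
  have h2 : ∀ᵐ q ∂P.map (fun ω => (ψ ω, fun i => (X i ω, A i ω))),
      condDistrib (fun ω a => θ a ω) (fun ω => (ψ ω, fun i => (X i ω, A i ω))) P q
        = (p.priorKernel.comap Prod.fst measurable_fst :
          Kernel (EuclideanSpace ℝ (Fin d') × (Fin n → 𝒳 × Fin K)) _) q := by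
    have h3 : ∀ᵐ q ∂P.map (fun ω => (ψ ω, fun i => (X i ω, A i ω))),
        condDistrib (fun ω a => θ a ω) ψ P q.1 = p.priorKernel q.1 := by
      refine ae_of_ae_map (f := Prod.fst) (p := fun z =>
        condDistrib (fun ω a => θ a ω) ψ P z = p.priorKernel z) measurable_fst.aemeasurable ?_
      rw [Measure.map_map measurable_fst (hψ.prodMk hD)]
      exact hM.condDistrib_action
    filter_upwards [hM.design_indep_action, h3] with q h4 h5
    rw [h4, h5, Kernel.comap_apply]
  have h3 : P.map (fun ω => ((ψ ω, fun i => (X i ω, A i ω)), fun a => θ a ω))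
      = ((P.map fun ω i => (X i ω, A i ω)).prod
        (multivariateGaussian p.latMean p.latCov ⊗ₘ p.priorKernel)).map
          (fun q => ((q.2.1, q.1), q.2.2)) := by
    rw [map_prod_compProd, ← h1, ← compProd_map_condDistrib hT.aemeasurable]
    exact Measure.compProd_congr h2
  have h4 := congrArg (Measure.map fun q => (q.1.2, (q.1.1, q.2))) h3
  rw [Measure.map_map (by fun_prop) ((hψ.prodMk hD).prodMk hT),
    Measure.map_map (by fun_prop) (by fun_prop)]
    at h4
  exact h4.trans Measure.map_id

/-- The reference law of the sample. -/
def sampleRef (P : Measure Ω) (X : Fin n → Ω → 𝒳) (A : Fin n → Ω → Fin K) :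
    Measure (Fin n → 𝒳 × Fin K × ℝ) :=
  ((P.map fun ω i => (X i ω, A i ω)).prod volume).map assembleSample

instance : SFinite (sampleRef P X A) := by unfold sampleRef; infer_instance

theorem condDistrib_rewards (hσ : 0 < p.σ) (hM : IsHierModel p P ψ θ X A R) :
    ∀ᵐ q ∂P.map (fun ω => (ψ ω, (fun a => θ a ω), fun j => (X j ω, A j ω))),
      condDistrib (fun ω i => R i ω) (fun ω => (ψ ω, (fun a => θ a ω), fun j => (X j ω, A j ω))) P q
        = (volume : Measure (Fin n → ℝ)).withDensity
          fun r => p.likelihood (assembleSample (q.2.2, r)) q.2.1 := by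
  filter_upwards [hM.reward_indep, ae_all_iff.mpr hM.reward_law] with q h1 h2
  rw [h1]
  simp only [h2]
  exact pi_eq_withDensity_fin (fun _ => volume) _
    (fun i => gaussianPDF (inner ℝ (p.φ (q.2.2 i).1) (q.2.1 (q.2.2 i).2)) (p.σ ^ 2).toNNReal)
    (fun i => measurable_gaussianPDF _ _) fun i => gaussianReal_of_var_ne_zero _ (by
      simpa using hσ.ne')

/-- The only use of the model needed for Bayes' rule: every posterior is read off this density. -/
theorem map_sample_params (hφ : Measurable p.φ) (hσ : 0 < p.σ) (hM : IsHierModel p P ψ θ X A R) :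
    P.map (fun ω => (sampleSet X A R ω, (ψ ω, fun a => θ a ω)))
      = ((sampleRef P X A).prod
          (multivariateGaussian p.latMean p.latCov ⊗ₘ p.priorKernel)).withDensity
        fun q => p.likelihood q.1 q.2.2 := by
  have hD := hM.measurable_design
  have hT := hM.measurable_params
  have hψ := hM.meas_latent
  have hR := hM.measurable_rewards
  set Q : Ω → EuclideanSpace ℝ (Fin d') × (Fin K → EuclideanSpace ℝ (Fin d)) ×
    (Fin n → 𝒳 × Fin K) := fun ω => (ψ ω, (fun a => θ a ω), fun j => (X j ω, A j ω)) with hQdef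
  have hQ : Measurable Q := hψ.prodMk (hT.prodMk hD)
  set h : (EuclideanSpace ℝ (Fin d') × (Fin K → EuclideanSpace ℝ (Fin d)) ×
      (Fin n → 𝒳 × Fin K)) → (Fin n → ℝ) → ENNReal :=
    fun q r => p.likelihood (assembleSample (q.2.2, r)) q.2.1 with hh
  have hhm : Measurable (Function.uncurry h) :=
    p.measurable_likelihood hφ (by fun_prop) (by fun_prop)
  have : IsSFiniteKernel ((Kernel.const (EuclideanSpace ℝ (Fin d') ×
      (Fin K → EuclideanSpace ℝ (Fin d)) × (Fin n → 𝒳 × Fin K))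
        (volume : Measure (Fin n → ℝ))).withDensity h) :=
    Kernel.IsSFiniteKernel.withDensity _ fun q r => p.likelihood_ne_top _ _
  have h1 : P.map (fun ω => (Q ω, fun i => R i ω))
      = ((P.map Q).prod volume).withDensity fun q => h q.1 q.2 := by
    rw [← compProd_map_condDistrib hR.aemeasurable, ← Measure.compProd_const,
      ← Measure.compProd_withDensity hhm]
    refine Measure.compProd_congr ?_
    filter_upwards [hM.condDistrib_rewards hσ] with q hq
    rw [hq, Kernel.withDensity_apply _ hhm, Kernel.const_apply]
  have hf : Measurable fun q : (EuclideanSpace ℝ (Fin d') × (Fin K → EuclideanSpace ℝ (Fin d)) ×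
      (Fin n → 𝒳 × Fin K)) × (Fin n → ℝ) =>
      (assembleSample (q.1.2.2, q.2), (q.1.1, q.1.2.1)) := by fun_prop
  have hLm : Measurable fun q : (Fin n → 𝒳 × Fin K × ℝ) ×
      (EuclideanSpace ℝ (Fin d') × (Fin K → EuclideanSpace ℝ (Fin d))) =>
        p.likelihood q.1 q.2.2 :=
    p.measurable_likelihood hφ measurable_fst (by fun_prop)
  have hsample : (fun ω => (sampleSet X A R ω, (ψ ω, fun a => θ a ω)))
      = (fun q : (EuclideanSpace ℝ (Fin d') × (Fin K → EuclideanSpace ℝ (Fin d)) ×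
        (Fin n → 𝒳 × Fin K)) × (Fin n → ℝ) => (assembleSample (q.1.2.2, q.2), (q.1.1, q.1.2.1)))
        ∘ fun ω => (Q ω, fun i => R i ω) := rfl
  -- The density depends on the design and rewards only through the assembled sample, so it survives
  -- the push-forward.
  have h2 := map_withDensity_comp ((P.map Q).prod (volume : Measure (Fin n → ℝ))) hf hLm
  rw [hsample, ← Measure.map_map hf (hQ.prodMk hR), h1]
  refine h2.trans ?_
  have h3 : P.map Q = ((P.map fun ω i => (X i ω, A i ω)).prod
      (multivariateGaussian p.latMean p.latCov ⊗ₘ p.priorKernel)).map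
        fun q => (q.2.1, q.2.2, q.1) := by
    rw [← hM.map_design_params, Measure.map_map (by fun_prop) (hD.prodMk (hψ.prodMk hT))]
    rfl
  rw [h3, map_prod_prod_rearrange _ _ _ measurable_assembleSample, sampleRef]

end IsHierModel

/-! ### Posterior laws -/

namespace HierParams

variable {𝒳 : Type*} {d d' K n : ℕ} (p : HierParams 𝒳 d d' K)

theorem map_eval_condPostKernel (s : Fin n → 𝒳 × Fin K × ℝ) (a : Fin K)
    (z : EuclideanSpace ℝ (Fin d')) :
    (p.condPostKernel s z).map (fun t => t a)
      = multivariateGaussian (p.condPostMean s a z) (p.condPostCov s a) :=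
  (measurePreserving_eval (fun a => multivariateGaussian (p.condPostMean s a z)
    (p.condPostCov s a)) a).map_eq

theorem map_eval_jointPost (hL : p.latCov.PosDef) (hA : ∀ a, (p.actCov a).PosDef)
    (s : Fin n → 𝒳 × Fin K × ℝ) (a : Fin K) :
    (p.jointPost s).map (fun q => q.2 a)
      = multivariateGaussian (p.condPostMean s a (p.latPostMean s)) (p.margPostCov s a) := by
  have hev : Measurable fun t : Fin K → EuclideanSpace ℝ (Fin d) => t a := measurable_pi_apply a
  have : IsMarkovKernel ((p.condPostKernel s).map fun t => t a) := Kernel.IsMarkovKernel.map _ hev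
  have h := bind_multivariateGaussian (p.posDef_latPostPrec hL hA s).inv.posSemidef
    (p.posDef_condPostCov hA s a).posSemidef (p.latPostMean s)
    (p.condPostCov s a * (p.actCov a)⁻¹ * p.W a)
    (Matrix.toEuclideanLin (p.condPostCov s a) (p.B s a))
    ((p.condPostKernel s).map fun t => t a) fun z => by
      rw [Kernel.map_apply _ hev, map_eval_condPostKernel, condPostMean_eq]
  rw [Measure.compProd_map hev, Measure.snd, Measure.map_map (by fun_prop) (by fun_prop)] at h
  rw [condPostMean_eq, margPostCov_eq p hA]
  exact h

end HierParams

namespace IsHierModel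

variable {Ω 𝒳 : Type*} [MeasurableSpace Ω] [MeasurableSpace 𝒳] {d d' K n : ℕ}
  {p : HierParams 𝒳 d d' K} {P : Measure Ω} [IsProbabilityMeasure P]
  {ψ : Ω → EuclideanSpace ℝ (Fin d')} {θ : Fin K → Ω → EuclideanSpace ℝ (Fin d)}
  {X : Fin n → Ω → 𝒳} {A : Fin n → Ω → Fin K} {R : Fin n → Ω → ℝ}

theorem measurable_sampleSet (hM : IsHierModel p P ψ θ X A R) : Measurable (sampleSet X A R) :=
  measurable_pi_lambda _ fun i => (hM.meas_X i).prodMk ((hM.meas_A i).prodMk (hM.meas_R i))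

theorem condDistrib_joint (hφ : Measurable p.φ) (hσ : 0 < p.σ) (hL : p.latCov.PosDef)
    (hA : ∀ a, (p.actCov a).PosDef) (hM : IsHierModel p P ψ θ X A R) :
    ∀ᵐ s ∂P.map (sampleSet X A R),
      condDistrib (fun ω => (ψ ω, fun a => θ a ω)) (sampleSet X A R) P s = p.jointPost s := by
  set π := multivariateGaussian p.latMean p.latCov ⊗ₘ p.priorKernel with hπ
  set L : (Fin n → 𝒳 × Fin K × ℝ) → EuclideanSpace ℝ (Fin d') × (Fin K → EuclideanSpace ℝ (Fin d)) →
    ENNReal := fun s q => p.likelihood s q.2 with hLdef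
  have hLm : Measurable (Function.uncurry L) :=
    p.measurable_likelihood hφ measurable_fst (by fun_prop)
  have : IsSFiniteKernel ((Kernel.const (Fin n → 𝒳 × Fin K × ℝ) π).withDensity L) :=
    Kernel.IsSFiniteKernel.withDensity _ fun s q => p.likelihood_ne_top _ _
  refine condDistrib_ae_eq_of_map_eq_compProd (hM.meas_latent.prodMk hM.measurable_params)
    ((Kernel.const (Fin n → 𝒳 × Fin K × ℝ) π).withDensity L) (ρ := sampleRef P X A) ?_
    p.jointPost fun s => ?_
  · rw [hM.map_sample_params hφ hσ, Measure.compProd_withDensity hLm, Measure.compProd_const]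
  · rw [Kernel.withDensity_apply _ hLm]
    exact p.prior_withDensity_likelihood hφ hσ hL hA s

/-- Bayes' rule with ψ on the conditioning side. The base measure is prior times reference law, not
the law of (ψ, S); the normalizer accounts for the difference. -/
theorem condDistrib_action_latent_sample (hφ : Measurable p.φ) (hσ : 0 < p.σ)
    (hA : ∀ a, (p.actCov a).PosDef) (hM : IsHierModel p P ψ θ X A R) :
    ∀ᵐ q ∂P.map (fun ω => (ψ ω, sampleSet X A R ω)),
      condDistrib (fun ω a => θ a ω) (fun ω => (ψ ω, sampleSet X A R ω)) P q
        = p.condPostKernel q.2 q.1 := by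
  set κ : Kernel (EuclideanSpace ℝ (Fin d') × (Fin n → 𝒳 × Fin K × ℝ))
    (Fin K → EuclideanSpace ℝ (Fin d)) := p.priorKernel.comap Prod.fst measurable_fst with hκ
  set L : EuclideanSpace ℝ (Fin d') × (Fin n → 𝒳 × Fin K × ℝ) →
    (Fin K → EuclideanSpace ℝ (Fin d)) → ENNReal := fun q t => p.likelihood q.2 t with hLdef
  have hLm : Measurable (Function.uncurry L) :=
    p.measurable_likelihood hφ (by fun_prop) measurable_snd
  have : IsSFiniteKernel (κ.withDensity L) :=
    Kernel.IsSFiniteKernel.withDensity _ fun s q => p.likelihood_ne_top _ _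
  refine condDistrib_ae_eq_of_map_eq_compProd hM.measurable_params (κ.withDensity L)
    (ρ := (multivariateGaussian p.latMean p.latCov).prod (sampleRef P X A)) ?_
    (fun q => p.condPostKernel q.2 q.1) fun q => ?_
  · have he : Measurable fun q : (Fin n → 𝒳 × Fin K × ℝ) ×
        (EuclideanSpace ℝ (Fin d') × (Fin K → EuclideanSpace ℝ (Fin d))) =>
        ((q.2.1, q.1), q.2.2) := by fun_prop
    rw [Measure.compProd_withDensity hLm, hκ, ← map_prod_compProd]
    refine Eq.trans ?_ (map_withDensity_comp _ he hLm)
    refine Eq.trans ?_ (congrArg (Measure.map _) (hM.map_sample_params hφ hσ))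
    rw [Measure.map_map he
      (hM.measurable_sampleSet.prodMk (hM.meas_latent.prodMk hM.measurable_params))]
    rfl
  · obtain ⟨c, hc, h⟩ := p.priorKernel_withDensity_likelihood hσ hA q.2
    have hq := h q.1
    rw [Kernel.withDensity_apply _ hLm, hκ, Kernel.comap_apply]
    exact ⟨_, mul_ne_zero (ENNReal.ofReal_pos.mpr hc).ne'
      (ENNReal.ofReal_pos.mpr (Real.exp_pos _)).ne',
      ENNReal.mul_ne_top ENNReal.ofReal_ne_top ENNReal.ofReal_ne_top, hq⟩

end IsHierModel

theorem mainTheorem4 {Ω 𝒳 : Type*} [MeasurableSpace Ω] [MeasurableSpace 𝒳] {d d' K n : ℕ}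
    (p : HierParams 𝒳 d d' K) (hφ : Measurable p.φ) (hσ : 0 < p.σ)
    (hLatCov : p.latCov.PosDef) (hActCov : ∀ a, (p.actCov a).PosDef)
    (P : Measure Ω) [IsProbabilityMeasure P]
    (ψ : Ω → EuclideanSpace ℝ (Fin d')) (θ : Fin K → Ω → EuclideanSpace ℝ (Fin d))
    (X : Fin n → Ω → 𝒳) (A : Fin n → Ω → Fin K) (R : Fin n → Ω → ℝ)
    (hM : IsHierModel p P ψ θ X A R) :
    -- all the matrices inverted, and all the covariances below, are positive definite
    (∀ s : Fin n → 𝒳 × Fin K × ℝ, (p.latPostPrec s).PosDef ∧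
      ∀ a, (p.G s a + (p.actCov a)⁻¹).PosDef ∧ (p.margPostCov s a).PosDef) ∧
    -- latent posterior `ψ | S`, `S` the sample set
    (∀ᵐ s ∂(P.map (sampleSet X A R)), condDistrib ψ (sampleSet X A R) P s
      = multivariateGaussian (p.latPostMean s) (p.latPostCov s)) ∧
    -- conditional posterior `θ_a | ψ, S`
    (∀ a, ∀ᵐ q ∂(P.map fun ω => (ψ ω, sampleSet X A R ω)),
      condDistrib (θ a) (fun ω => (ψ ω, sampleSet X A R ω)) P q
      = multivariateGaussian (p.condPostMean q.2 a q.1) (p.condPostCov q.2 a)) ∧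
    CondIndepFamily θ (fun ω => (ψ ω, sampleSet X A R ω)) P ∧
    -- marginal posterior `θ_a | S`
    (∀ a, ∀ᵐ s ∂(P.map (sampleSet X A R)), condDistrib (θ a) (sampleSet X A R) P s
      = multivariateGaussian (p.condPostMean s a (p.latPostMean s)) (p.margPostCov s a)) := by
  have hS := hM.measurable_sampleSet
  have hjoint := hM.condDistrib_joint hφ hσ hLatCov hActCov
  have hcond := hM.condDistrib_action_latent_sample hφ hσ hActCov
  have hjm : Measurable fun ω => (ψ ω, fun a => θ a ω) :=
    hM.meas_latent.prodMk hM.measurable_params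
  have hact : ∀ a, ∀ᵐ q ∂(P.map fun ω => (ψ ω, sampleSet X A R ω)),
      condDistrib (θ a) (fun ω => (ψ ω, sampleSet X A R ω)) P q
      = multivariateGaussian (p.condPostMean q.2 a q.1) (p.condPostCov q.2 a) := fun a => by
    have hev : Measurable fun t : Fin K → EuclideanSpace ℝ (Fin d) => t a := measurable_pi_apply a
    filter_upwards [hcond, condDistrib_comp (fun ω => (ψ ω, sampleSet X A R ω))
      hM.measurable_params.aemeasurable hev] with q h1 h2
    rw [← p.map_eval_condPostKernel, ← h1, ← Kernel.map_apply _ hev, ← h2]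
    rfl
  refine ⟨fun s => ⟨p.posDef_latPostPrec hLatCov hActCov s, fun a =>
    ⟨p.posDef_actPrec hActCov s a, p.posDef_margPostCov hLatCov hActCov s a⟩⟩, ?_, hact, ?_,
    fun a => ?_⟩
  · filter_upwards [hjoint, condDistrib_comp (sampleSet X A R) hjm.aemeasurable measurable_fst]
      with s h1 h2
    have h3 := Measure.fst_compProd (multivariateGaussian (p.latPostMean s) (p.latPostCov s))
      (p.condPostKernel s)
    rw [← h3]
    change _ = (p.jointPost s).map Prod.fst
    rw [← h1, ← Kernel.map_apply _ measurable_fst, ← h2]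
    rfl
  -- The joint conditional law is a product whose factors are the conditional laws already found in
  -- `hact`.
  · filter_upwards [hcond, ae_all_iff.mpr hact] with q h1 h2
    rw [h1]
    simp only [h2]
    rfl
  · have hev : Measurable fun q : EuclideanSpace ℝ (Fin d') ×
        (Fin K → EuclideanSpace ℝ (Fin d)) => q.2 a := by fun_prop
    filter_upwards [hjoint, condDistrib_comp (sampleSet X A R) hjm.aemeasurable hev] with s h1 h2
    rw [← p.map_eval_jointPost hLatCov hActCov, ← h1, ← Kernel.map_apply _ hev, ← h2]
    rfl

end
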